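/- Let $G(\mathcal V,\mathcal E)$ be a directed graph without self-loops on $\mathcal V=\{1,\dots,n\}$, let $f\ge 0$ be an integer, and let $\mathcal F\subseteq\mathcal V$ with $|\mathcal F|\le f$ be the set of Byzantine faulty agents. Write $N_i^-=\{j:(j,i)\in\mathcal E\}$. Let $h_1,\dots,h_k:\mathbb R\to\mathbb R$ be convex and $L$-Lipschitz, each with a non-empty compact set of minimizers, and suppose that they are solution-redundant: $\bigcap_{j=1}^k\operatorname{argmin}h_j\neq\emptyset$. Let $\mathbf A\in\mathbb R^{k\times n}$ have nonnegative entries with $\sum_{j=1}^k\mathbf A_{ji}=1$ for every $i$, and let agent $i$ have the local cost function $g_i=\sum_{j=1}^k\mathbf A_{ji}h_j$. The sparsity parameter $sp(\mathbf A)$ is the smallest integer $s$ such that the sum of any $s$ columns of $\mathbf A$ is positive in every coordinate, and $sp(\mathbf A)=n+1$ if the sum of all columns is not positive in every coordinate. A reduced graph of $G$ for a set $\mathcal F'\subseteq\mathcal V$ is obtained by removing the agents of $\mathcal F'$ with their edges and then removing, at each remaining agent, up to $f$ further incoming edges. The source component of a directed graph is the set of nodes that have a directed path to every other node. Assume Condition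 1: for every $\mathcal F'\subseteq\mathcal V$ with $|\mathcal F'|\le f$, the source component of every reduced graph of $G$ for $\mathcal F'$ has at least $\max\{f+1,sp(\mathbf A)\}$ nodes. Let $\alpha(t)\ge 0$ $(t\ge 0)$ be step sizes with $\sum_t\alpha(t)=\infty$ and $\sum_t\alpha(t)^2<\infty$. Consider any execution of the following algorithm (Algorithm 2), with arbitrary initial states $x_i(0)\in\mathbb R$ of the non-faulty agents. In iteration $t\ge1$ every non-faulty agent sends $x_i(t-1)$ to its out-neighbours, while a faulty agent may send arbitrary real values, different ones to different neighbours. Every non-faulty agent $i$ receives a value $w_j$ from each $j\in N_i^-$, discards $f$ senders of smallest and $f$ senders of largest values (ties broken arbitrarily), and, with $N_i^*(t)$ the set of the remaining senders and $w_i=x_i(t-1)$, sets $$x_i(t)=\sum_{j\in\{i\}\cup N_i^*(t)}\frac{1}{|N_i^*(t)|+1}\,w_j-\alpha(t-1)\,d_i(t-1),$$ where $d_i(t-1)$ is any subgradient of $g_i$ at $x_i(t-1)$. Then there is a point $x^*\in\operatorname{argmin}\frac1k\sum_{j=1}^k h_j$ such that $\lim_{t\to\infty}x_i(t)=x^*$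 for every non-faulty agent $i\in\mathcal V\setminus\mathcal F$. -/

import Mathlib

open Filter Topology
open scoped NNReal

namespace ByzOpt

/-- The set of global minimizers of a real function. -/
def argminSet (h : ℝ → ℝ) : Set ℝ := {x | ∀ y, h x ≤ h y}

/-- Admissible functions: convex, `L`-Lipschitz, with non-empty compact set of minimizers. -/
structure Admissible (L : ℝ≥0) (h : ℝ → ℝ) : Prop where
  convex : ConvexOn ℝ Set.univ h
  lipschitz : LipschitzWith L h
  nonempty : (argminSet h).Nonempty
  compact : IsCompact (argminSet h)

/-- `d` is a subgradient of `g` at `x`. -/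
def IsSubgradientAt (g : ℝ → ℝ) (x d : ℝ) : Prop := ∀ y, g x + d * (y - x) ≤ g y

/-- Job assignment matrix: nonnegative entries, every column sums to one. -/
structure IsAssignment {k n : ℕ} (A : Matrix (Fin k) (Fin n) ℝ) : Prop where
  nonneg : ∀ j i, 0 ≤ A j i
  col_sum : ∀ i, ∑ j, A j i = 1

/-- The local cost function of agent `i`: the combination of the input functions
with the weights in column `i` of `A`. -/
def localCost {k n : ℕ} (A : Matrix (Fin k) (Fin n) ℝ) (h : Fin k → ℝ → ℝ) (i : Fin n) :
    ℝ → ℝ := fun x => ∑ j, A j i * h j x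

/-- The global objective: the average of the input functions. -/
noncomputable def globalCost {k : ℕ} (h : Fin k → ℝ → ℝ) : ℝ → ℝ :=
  fun x => (1 / (k : ℝ)) * ∑ j, h j x

open Classical in
/-- Sparsity parameter: the least `s` such that the sum of any `s` columns is positive in every
coordinate; by convention `n + 1` if the sum of all columns is not positive in every
coordinate. -/
noncomputable def sparsity {k n : ℕ} (A : Matrix (Fin k) (Fin n) ℝ) : ℕ :=
  if ∀ j, 0 < ∑ i, A j i then
    sInf {s : ℕ | ∀ I : Finset (Fin n), I.card = s → ∀ j, 0 < ∑ i ∈ I, A j i}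
  else n + 1

/-- `H` is a reduced graph of `G` for the fault set `F`: the nodes in `F` are removed with
their edges, and at every remaining node up to `f` further incoming edges are removed.
An edge from `i` to `j` is `G.Adj i j`. -/
structure IsReduced {n : ℕ} (G : Digraph (Fin n)) (f : ℕ) (F : Finset (Fin n))
    (H : Digraph {i : Fin n // i ∉ F}) : Prop where
  sub : ∀ i j : {i : Fin n // i ∉ F}, H.Adj i j → G.Adj i j
  removed : ∀ j : {i : Fin n // i ∉ F},
    {i : {i : Fin n // i ∉ F} | G.Adj i j ∧ ¬ H.Adj i j}.ncard ≤ f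

/-- The source component: the nodes with a directed path to every other node. -/
def sourceComponent {V : Type*} (H : Digraph V) : Set V :=
  {v | ∀ u, u ≠ v → Relation.ReflTransGen H.Adj v u}

/-- For every possible fault set of at most `f` agents, every reduced graph has a
source component with at least `max (f + 1) s` nodes. -/
def SourceCondition {n : ℕ} (G : Digraph (Fin n)) (f s : ℕ) : Prop :=
  ∀ F : Finset (Fin n), F.card ≤ f → ∀ H : Digraph {i : Fin n // i ∉ F},
    IsReduced G f F H → max (f + 1) s ≤ (sourceComponent H).ncard

open Classical in
/-- Incoming neighbours of `i`. -/
noncomputable def inNbrs {n : ℕ} (G : Digraph (Fin n)) (i : Fin n) : Finset (Fin n) :=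
  Finset.univ.filter fun j => G.Adj j i

/-- `K` is what remains of the senders `N`, with values `w`, after `f` senders of smallest value
and `f` senders of largest value have been eliminated, ties being broken arbitrarily. -/
def IsTrimming {n : ℕ} (f : ℕ) (N : Finset (Fin n)) (w : Fin n → ℝ)
    (K : Finset (Fin n)) : Prop :=
  ∃ Lo Hi : Finset (Fin n), Lo ⊆ N ∧ Hi ⊆ N ∧ Disjoint Lo Hi ∧ Lo.card = f ∧ Hi.card = f ∧
    K = N \ (Lo ∪ Hi) ∧
    (∀ a ∈ Lo, ∀ b ∈ N \ Lo, w a ≤ w b) ∧ (∀ a ∈ Hi, ∀ b ∈ N \ Hi, w b ≤ w a)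

/-- `x` is a sequence of local estimates of the non-faulty agents in an execution of
trimmed-mean consensus with subgradient steps. In iteration `t`, `w t i j` is the value that
agent `i` receives from its incoming neighbour `j` (unconstrained if `j` is faulty),
`w t i i` is the own state of `i`, `K t i` is the set of senders that survive the trimming,
and `d t i` is the subgradient used by `i` at its state `x t i`. -/
structure IsExecution {n : ℕ} (G : Digraph (Fin n)) (f : ℕ) (F : Finset (Fin n))
    (g : Fin n → ℝ → ℝ) (α : ℕ → ℝ) (x : ℕ → Fin n → ℝ) (w : ℕ → Fin n → Fin n → ℝ)
    (K : ℕ → Fin n → Finset (Fin n)) (d : ℕ → Fin n → ℝ) : Prop where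
  own : ∀ t, ∀ i ∉ F, w (t + 1) i i = x t i
  received : ∀ t, ∀ i ∉ F, ∀ j ∈ inNbrs G i, j ∉ F → w (t + 1) i j = x t j
  trim : ∀ t, ∀ i ∉ F, IsTrimming f (inNbrs G i) (w (t + 1) i) (K (t + 1) i)
  subgrad : ∀ t, ∀ i ∉ F, IsSubgradientAt (g i) (x t i) (d t i)
  update : ∀ t, ∀ i ∉ F, x (t + 1) i =
    ∑ j ∈ insert i (K (t + 1) i), (1 / (((K (t + 1) i).card : ℝ) + 1)) * w (t + 1) i j
      - α t * d t i

end ByzOpt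

namespace ByzOpt

/-! Faulty agents cannot be identified, but their influence can be rewritten. A value that survives
the trimming lies between the states of the non-faulty senders discarded below it and above it, and
if it comes from a faulty sender, then both groups are non-empty. So it is a convex combination of
non-faulty states, with substantial weight on all of one of the two groups. Hence the non-faulty
states obey `x (t+1) = M t x t - α t • d t` with `M t` row-stochastic, its entries at least `β =
1/(4n²)` on the diagonal and along the edges of a reduced graph (`exists_trimmedMean_weights`,
`IsExecution.exists_rowStochastic`). In long backward products of these matrices, all columns of the
source component of one of the graphs are bounded below (`exists_source_columns_le_transition`).

Let `z` be a common minimizer. All drifts point towards `z`, so the largest squared distance to `z`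
converges, up to the summable error `∑ α²` (`exists_tendsto_iSup_sq_sub`). The bounded columns make
the spread of the states vanish (`tendsto_spread_zero`). Together these give a common limit `p`
(`exists_bound_and_common_limit`).

If `p` did not minimize some `h j`, then near `p` every agent with positive weight on `h j` would
have a drift towards `z` bounded away from zero, and no agent would drift away from `z`. A source
component with at least `sparsity A` nodes contains such an agent, whose drift then reaches all
others. Since the states stay bounded, this forces `∑ α < ∞` (`summable_of_eventually_drift`), a
contradiction. -/

theorem le_iSup_of_finite {V : Type*} [Finite V] (u : V → ℝ) (i : V) : u i ≤ ⨆ j, u j :=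
  le_ciSup (Set.finite_range u).bddAbove i

theorem iInf_le_of_finite {V : Type*} [Finite V] (u : V → ℝ) (i : V) : ⨅ j, u j ≤ u i :=
  ciInf_le (Set.finite_range u).bddBelow i

/-! ### Backward products of row-stochastic matrices -/

section Transition

variable {V : Type*} [Fintype V] [DecidableEq V]

/-- The backward product `M (s + N - 1) * ⋯ * M s` of a sequence of matrices. -/
def transition (M : ℕ → Matrix V V ℝ) (s : ℕ) : ℕ → Matrix V V ℝ
  | 0 => 1
  | N + 1 => M (s + N) * transition M s N

theorem transition_mem_rowStochastic {M : ℕ → Matrix V V ℝ}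
    (hM : ∀ t, M t ∈ Matrix.rowStochastic ℝ V) (s N : ℕ) :
    transition M s N ∈ Matrix.rowStochastic ℝ V := by
  induction N with
  | zero => exact one_mem _
  | succ N ih => exact mul_mem (hM _) ih

theorem mul_le_transition_succ {M : ℕ → Matrix V V ℝ}
    (hM : ∀ t, M t ∈ Matrix.rowStochastic ℝ V) (s N : ℕ) (i a j : V) :
    M (s + N) i a * transition M s N a j ≤ transition M s (N + 1) i j := by
  rw [transition, Matrix.mul_apply]
  exact Finset.single_le_sum (f := fun b => M (s + N) i b * transition M s N b j)
    (fun b _ => mul_nonneg ((hM _).1 i b) ((transition_mem_rowStochastic hM s N).1 b j))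
    (Finset.mem_univ a)

/-- Some column of a sufficiently long backward product is bounded below, namely every column
that belongs to a source of one of the graphs. -/
theorem exists_source_columns_le_transition {M : ℕ → Matrix V V ℝ} {H : ℕ → Digraph V} {β : ℝ}
    (hM : ∀ t, M t ∈ Matrix.rowStochastic ℝ V) (hβ : 0 ≤ β) (hdiag : ∀ t i, β ≤ M t i i)
    (hedge : ∀ t i j, (H t).Adj j i → β ≤ M t i j) (s : ℕ) :
    ∃ t, ∀ j ∈ sourceComponent (H t), ∀ i,
      β ^ (Fintype.card (V × V) + 1) ≤ transition M s (Fintype.card (V × V) + 1) i j := by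
  classical
  set R : ℕ → Finset (V × V) := fun m =>
    Finset.univ.filter fun p => β ^ m ≤ transition M s m p.1 p.2 with hR
  have hstep : ∀ m i a j, (a, j) ∈ R m → β ≤ M (s + m) i a → (i, j) ∈ R (m + 1) := by
    intro m i a j ha hle
    simp only [hR, Finset.mem_filter, Finset.mem_univ, true_and] at ha ⊢
    refine le_trans ?_ (mul_le_transition_succ hM s m i a j)
    rw [pow_succ']
    exact mul_le_mul hle ha (pow_nonneg hβ m) (hβ.trans hle)
  have hmono : Monotone R :=
    monotone_nat_of_le_succ fun m p hp => hstep m p.1 p.1 p.2 hp (hdiag _ _)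
  -- Pigeonhole: the increasing sets `R m` of pairs cannot grow strictly at each of `card (V × V) +
  -- 1` steps.
  obtain ⟨m, hm, hstab⟩ : ∃ m < Fintype.card (V × V) + 1, R (m + 1) = R m := by
    by_contra! hcon
    have hcard : ∀ m ≤ Fintype.card (V × V) + 1, m ≤ (R m).card := by
      intro m
      induction m with
      | zero => simp
      | succ m ih =>
        intro hm
        have hlt : R m ⊂ R (m + 1) :=
          (hmono (Nat.le_succ m)).lt_of_ne (hcon m (by omega)).symm
        have := Finset.card_lt_card hlt
        have := ih (by omega)
        omega
    have h1 := hcard _ le_rfl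
    have h2 := Finset.card_le_univ (R (Fintype.card (V × V) + 1))
    omega
  -- Where `R` stops growing, `R m` is already closed under the edges of `H (s + m)`. So it contains
  -- everything reachable from `(j, j)` along this single graph, although the graphs vary with time.
  refine ⟨s + m, fun j hj i => ?_⟩
  have hjj : (j, j) ∈ R m := hmono (Nat.zero_le m) (by simp [hR, transition])
  have hreach : ∀ u, Relation.ReflTransGen (H (s + m)).Adj j u → (u, j) ∈ R m := by
    intro u hu
    induction hu with
    | refl => exact hjj
    | tail _ hbc ih => exact hstab ▸ hstep m _ _ j ih (hedge _ _ _ hbc)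
  have hij : (i, j) ∈ R m := by
    by_cases h : i = j
    · exact h ▸ hjj
    · exact hreach i (hj i h)
  simpa [hR] using hmono hm.le hij

/-- Averaging an upper bound, with weight at least `γ` on an entry `j`. -/
theorem mulVec_le_sub_of_mem_rowStochastic {P : Matrix V V ℝ} (hP : P ∈ Matrix.rowStochastic ℝ V)
    {u : V → ℝ} {b γ : ℝ} (hu : ∀ a, u a ≤ b) {i j : V} (hγ : γ ≤ P i j) :
    P.mulVec u i ≤ b - γ * (b - u j) := by
  have h1 : P i j * (b - u j) ≤ ∑ a, P i a * (b - u a) :=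
    Finset.single_le_sum (f := fun a => P i a * (b - u a))
      (fun a _ => mul_nonneg (hP.1 i a) (sub_nonneg.2 (hu a))) (Finset.mem_univ j)
  have h2 : ∑ a, P i a * (b - u a) = b - P.mulVec u i := by
    simp only [mul_sub, Finset.sum_sub_distrib, ← Finset.sum_mul,
      Matrix.sum_row_of_mem_rowStochastic hP, one_mul, Matrix.mulVec, dotProduct]
  have h3 := mul_le_mul_of_nonneg_right hγ (sub_nonneg.2 (hu j))
  linarith

theorem mulVec_le_of_mem_rowStochastic {P : Matrix V V ℝ} (hP : P ∈ Matrix.rowStochastic ℝ V)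
    {u : V → ℝ} {b : ℝ} (hu : ∀ a, u a ≤ b) (i : V) : P.mulVec u i ≤ b := by
  simpa using mulVec_le_sub_of_mem_rowStochastic hP hu (hP.1 i i)

theorem add_le_mulVec_of_mem_rowStochastic {P : Matrix V V ℝ} (hP : P ∈ Matrix.rowStochastic ℝ V)
    {u : V → ℝ} {b γ : ℝ} (hu : ∀ a, b ≤ u a) {i j : V} (hγ : γ ≤ P i j) :
    b + γ * (u j - b) ≤ P.mulVec u i := by
  have := mulVec_le_sub_of_mem_rowStochastic hP (u := -u) (b := -b)
    (fun a => neg_le_neg (hu a)) hγ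
  rw [Matrix.mulVec_neg, Pi.neg_apply, Pi.neg_apply] at this
  linarith

theorem abs_mulVec_le_of_mem_rowStochastic {P : Matrix V V ℝ}
    (hP : P ∈ Matrix.rowStochastic ℝ V) {u : V → ℝ} {b : ℝ} (hu : ∀ a, |u a| ≤ b) (i : V) :
    |P.mulVec u i| ≤ b := by
  refine abs_le.2 ⟨?_, mulVec_le_of_mem_rowStochastic hP (fun a => (abs_le.1 (hu a)).2) i⟩
  have := add_le_mulVec_of_mem_rowStochastic hP (fun a => (abs_le.1 (hu a)).1) (hP.1 i i)
  linarith [mul_nonneg (hP.1 i i) (sub_nonneg.2 (abs_le.1 (hu i)).1)]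

/-! ### Averaging with drift: spread, accumulated drift, distance to a target -/

variable {M : ℕ → Matrix V V ℝ} {x d : ℕ → V → ℝ} {α : ℕ → ℝ}

/-- Row-stochastic matrices do not expand the sup norm, so the perturbations of the single steps
merely add up. -/
theorem abs_sub_transition_mulVec_le (hM : ∀ t, M t ∈ Matrix.rowStochastic ℝ V)
    (hx : ∀ t, x (t + 1) = (M t).mulVec (x t) - α t • d t) (hα : ∀ t, 0 ≤ α t) {C : ℝ}
    (hd : ∀ t i, |d t i| ≤ C) (s N : ℕ) (i : V) :
    |x (s + N) i - (transition M s N).mulVec (x s) i|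
      ≤ C * ∑ r ∈ Finset.range N, α (s + r) := by
  induction N generalizing i with
  | zero => simp [transition]
  | succ N ih =>
    have h1 := abs_mulVec_le_of_mem_rowStochastic (hM (s + N))
      (u := x (s + N) - (transition M s N).mulVec (x s)) ih i
    have h2 : |α (s + N) * d (s + N) i| ≤ α (s + N) * C := by
      rw [abs_mul, abs_of_nonneg (hα _)]
      exact mul_le_mul_of_nonneg_left (hd _ _) (hα _)
    have h3 : x (s + (N + 1)) i - (transition M s (N + 1)).mulVec (x s) i
        = (M (s + N)).mulVec (x (s + N) - (transition M s N).mulVec (x s)) i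
          - α (s + N) * d (s + N) i := by
      rw [← add_assoc, hx, transition, Matrix.mulVec_sub, Matrix.mulVec_mulVec]
      simp only [Pi.sub_apply, Pi.smul_apply, smul_eq_mul]
      ring
    rw [h3, Finset.sum_range_succ, mul_add]
    refine (abs_sub _ _).trans ?_
    linarith

/-- Once `e t < (1 - q) ε`, the excess of the bound over `ε` contracts: `q (q^m B + ε) + (1 - q) ε =
q^(m+1) B + ε`. -/
theorem tendsto_zero_of_le_mul_add {D e : ℕ → ℝ} {q B : ℝ} {N : ℕ} (hq : 0 ≤ q) (hq1 : q < 1)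
    (hD : ∀ t, 0 ≤ D t) (hB : ∀ t, D t ≤ B) (he : Tendsto e atTop (𝓝 0))
    (hstep : ∀ t, D (t + N) ≤ q * D t + e t) : Tendsto D atTop (𝓝 0) := by
  have key : ∀ ε > 0, ∀ m : ℕ, ∀ᶠ t in atTop, D t ≤ q ^ m * B + ε := by
    intro ε hε m
    induction m with
    | zero => exact Eventually.of_forall fun t => by linarith [hB t]
    | succ m ih =>
      have h1 : ∀ᶠ t in atTop, e t < (1 - q) * ε :=
        he.eventually (gt_mem_nhds (mul_pos (sub_pos.2 hq1) hε))
      rw [← map_add_atTop_eq_nat N, eventually_map]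
      filter_upwards [ih, h1] with t ht h1
      have := mul_le_mul_of_nonneg_left ht hq
      rw [pow_succ']
      linarith [hstep t]
  refine tendsto_order.2 ⟨fun a ha => Eventually.of_forall fun t => ha.trans_le (hD t),
    fun a ha => ?_⟩
  have h0 : Tendsto (fun m => q ^ m * B) atTop (𝓝 0) := by
    simpa using (tendsto_pow_atTop_nhds_zero_of_lt_one hq hq1).mul_const B
  obtain ⟨m, hm⟩ := (h0.eventually (gt_mem_nhds (half_pos ha))).exists
  filter_upwards [key (a / 2) (half_pos ha) m] with t ht
  linarith

/-- Perturbed consensus with vanishing perturbations. -/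
theorem tendsto_spread_zero [Nonempty V] (hM : ∀ t, M t ∈ Matrix.rowStochastic ℝ V)
    (hx : ∀ t, x (t + 1) = (M t).mulVec (x t) - α t • d t) (hα : ∀ t, 0 ≤ α t)
    (hα0 : Tendsto α atTop (𝓝 0)) {C : ℝ} (hd : ∀ t i, |d t i| ≤ C) {B : ℝ}
    (hB : ∀ t i, |x t i| ≤ B) {γ : ℝ} (hγ : 0 < γ) {N : ℕ}
    (hcol : ∀ s, ∃ j, ∀ i, γ ≤ transition M s N i j) :
    Tendsto (fun t => (⨆ i, x t i) - ⨅ i, x t i) atTop (𝓝 0) := by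
  have hγ1 : γ ≤ 1 := by
    obtain ⟨j, hj⟩ := hcol 0
    exact (hj j).trans (Matrix.le_one_of_mem_rowStochastic
      (transition_mem_rowStochastic hM 0 N))
  have he : Tendsto (fun s => 2 * (C * ∑ r ∈ Finset.range N, α (s + r))) atTop (𝓝 0) := by
    have h1 : Tendsto (fun s => ∑ r ∈ Finset.range N, α (s + r)) atTop
        (𝓝 (∑ r ∈ Finset.range N, (0 : ℝ))) :=
      tendsto_finsetSum _ fun r _ => (tendsto_add_atTop_iff_nat r).2 hα0
    simpa using (h1.const_mul C).const_mul 2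
  refine tendsto_zero_of_le_mul_add (q := 1 - γ) (B := B + B) (N := N) (by linarith)
    (by linarith) (fun t => ?_) (fun t => ?_) he fun s => ?_
  · obtain ⟨i⟩ := ‹Nonempty V›
    linarith [le_iSup_of_finite (x t) i, iInf_le_of_finite (x t) i]
  · have h1 : ⨆ i, x t i ≤ B := ciSup_le fun i => (abs_le.1 (hB t i)).2
    have h2 : -B ≤ ⨅ i, x t i := le_ciInf fun i => (abs_le.1 (hB t i)).1
    linarith
  -- The maximum falls by `γ (max - x j)` and the minimum rises by `γ (x j - min)`, up to the drift.
  -- The sum of the two gains is `γ` times the spread, whatever the value of `x j`.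
  · obtain ⟨j, hj⟩ := hcol s
    have hP := transition_mem_rowStochastic hM s N
    have h1 : ⨆ i, x (s + N) i ≤ (⨆ i, x s i) - γ * ((⨆ i, x s i) - x s j)
        + C * ∑ r ∈ Finset.range N, α (s + r) := ciSup_le fun i => by
      have := (abs_le.1 (abs_sub_transition_mulVec_le hM hx hα hd s N i)).2
      linarith [mulVec_le_sub_of_mem_rowStochastic hP (le_iSup_of_finite (x s)) (hj i)]
    have h2 : (⨅ i, x s i) + γ * (x s j - ⨅ i, x s i)
        - C * ∑ r ∈ Finset.range N, α (s + r) ≤ ⨅ i, x (s + N) i := le_ciInf fun i => by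
      have := (abs_le.1 (abs_sub_transition_mulVec_le hM hx hα hd s N i)).1
      linarith [add_le_mulVec_of_mem_rowStochastic hP (iInf_le_of_finite (x s)) (hj i)]
    linarith

/-- If the drift has eventually nonnegative coordinates, and infinitely often a coordinate with
lasting influence that is bounded away from zero, then bounded states force finitely much drift. -/
theorem summable_of_eventually_drift [Nonempty V] (hM : ∀ t, M t ∈ Matrix.rowStochastic ℝ V)
    (hx : ∀ t, x (t + 1) = (M t).mulVec (x t) - α t • d t) (hα : ∀ t, 0 ≤ α t) {B : ℝ}
    (hB : ∀ t i, |x t i| ≤ B) {γ c : ℝ} (hγ : 0 < γ) (hc : 0 < c) {N : ℕ} {S : Set V}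
    (hcol : ∀ s, ∃ j ∈ S, ∀ i, γ ≤ transition M s N i j)
    (hd : ∀ᶠ t in atTop, (∀ i, 0 ≤ d t i) ∧ ∀ i ∈ S, c ≤ d t i) : Summable α := by
  obtain ⟨T, hT⟩ := eventually_atTop.1 hd
  have hle : ∀ s ≥ T, ∀ m i, x (s + m) i ≤ (transition M s m).mulVec (x s) i := by
    intro s hs m
    induction m with
    | zero => simp [transition]
    | succ m ih =>
      intro i
      have h1 := mulVec_le_of_mem_rowStochastic (hM (s + m)) (b := 0)
        (u := x (s + m) - (transition M s m).mulVec (x s)) (fun a => sub_nonpos.2 (ih a)) i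
      rw [Matrix.mulVec_sub, Matrix.mulVec_mulVec] at h1
      have h2 := mul_nonneg (hα (s + m)) ((hT (s + m) (by omega)).1 i)
      rw [← add_assoc, hx, transition]
      simp only [Pi.sub_apply, Pi.smul_apply, smul_eq_mul] at h1 ⊢
      linarith
  set U : ℕ → ℝ := fun t => ⨆ i, x t i with hU
  have hUB : ∀ t, |U t| ≤ B := fun t => by
    obtain ⟨i⟩ := ‹Nonempty V›
    exact abs_le.2 ⟨(abs_le.1 (hB t i)).1.trans (le_iSup_of_finite (x t) i),
      ciSup_le fun i => (abs_le.1 (hB t i)).2⟩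
  -- One step lowers coordinate `j` by at least `c α s` below the old maximum; the next `N` steps
  -- pass a fraction `γ` of this on to every coordinate. Hence the lag `N + 1`.
  have hdec : ∀ s ≥ T, γ * c * α s ≤ U s - U (s + (N + 1)) := by
    intro s hs
    obtain ⟨j, hjS, hj⟩ := hcol (s + 1)
    have hu : ∀ a, x (s + 1) a ≤ U s - α s * d s a := fun a => by
      rw [hx]
      have := mulVec_le_of_mem_rowStochastic (hM s) (le_iSup_of_finite (x s)) a
      simp only [Pi.sub_apply, Pi.smul_apply, smul_eq_mul]
      linarith
    have h1 : U (s + (N + 1)) ≤ U s - γ * (c * α s) := ciSup_le fun i => by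
      have h2 := hle (s + 1) (by omega) N i
      have h3 := mulVec_le_sub_of_mem_rowStochastic (transition_mem_rowStochastic hM (s + 1) N)
        (u := x (s + 1)) (b := U s)
        (fun a => (hu a).trans (by linarith [mul_nonneg (hα s) ((hT s hs).1 a)])) (hj i)
      have h4 := mul_le_mul_of_nonneg_left ((hT s hs).2 j hjS) (hα s)
      have h5 := mul_le_mul_of_nonneg_left
        (show c * α s ≤ U s - x (s + 1) j by linarith [hu j]) hγ.le
      rw [show s + (N + 1) = s + 1 + N by ring]
      linarith
    linarith
  -- Differences at lag `N + 1` telescope to two blocks of `N + 1` terms, which are bounded because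
  -- `U` is.
  have htel : ∀ m, ∑ r ∈ Finset.range m, (U (T + r) - U (T + r + (N + 1)))
      = ∑ r ∈ Finset.range (N + 1), U (T + r)
        - ∑ r ∈ Finset.range (N + 1), U (T + m + r) := by
    intro m
    induction m with
    | zero => simp
    | succ m ih =>
      rw [Finset.sum_range_succ, ih]
      have h1 := Finset.sum_range_succ (fun r => U (T + m + r)) (N + 1)
      have h2 := Finset.sum_range_succ' (fun r => U (T + m + r)) (N + 1)
      have h3 : ∀ r, T + m + (r + 1) = T + (m + 1) + r := fun r => by ring
      simp only [h3, add_zero] at h2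
      linarith
  have hsum : Summable fun r => γ * c * α (T + r) := by
    refine summable_of_sum_range_le (c := 2 * ((N + 1) * B))
      (fun r => mul_nonneg (mul_pos hγ hc).le (hα _)) fun m => ?_
    have h1 : ∀ t, |∑ r ∈ Finset.range (N + 1), U (t + r)| ≤ (N + 1) * B := fun t => by
      refine (Finset.abs_sum_le_sum_abs _ _).trans ?_
      refine (Finset.sum_le_card_nsmul _ _ B fun r _ => hUB _).trans ?_
      simp
    have h2 := (abs_le.1 (h1 T)).2
    have h3 := (abs_le.1 (h1 (T + m))).1
    have h4 := Finset.sum_le_sum (s := Finset.range m)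
      fun r _ => hdec (T + r) (Nat.le_add_right T r)
    rw [htel] at h4
    linarith
  have h1 := (summable_mul_left_iff (mul_pos hγ hc).ne').1 hsum
  exact (summable_nat_add_iff T).1 (by simpa only [add_comm T] using h1)

/-- Quasi-Fejér monotonicity of the largest squared distance to a point towards which all
drifts are directed. -/
theorem exists_tendsto_iSup_sq_sub [Nonempty V] (hM : ∀ t, M t ∈ Matrix.rowStochastic ℝ V)
    (hx : ∀ t, x (t + 1) = (M t).mulVec (x t) - α t • d t) {β : ℝ} (hβ : 0 < β)
    (hdiag : ∀ t i, β ≤ M t i i) (hα_sq : Summable fun t => α t ^ 2) {C : ℝ}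
    (hd : ∀ t i, |d t i| ≤ C) {z : ℝ} (hz : ∀ t i, 0 ≤ d t i * (x t i - z))
    (hα : ∀ t, 0 ≤ α t) :
    ∃ e, Tendsto (fun t => ⨆ i, (x t i - z) ^ 2) atTop (𝓝 e) := by
  set E : ℕ → ℝ := fun t => ⨆ i, (x t i - z) ^ 2 with hE
  have hE0 : ∀ t, 0 ≤ E t := fun t => Real.iSup_nonneg fun i => sq_nonneg _
  have hstep : ∀ t, E (t + 1) ≤ E t + C ^ 2 / β * α t ^ 2 := fun t => ciSup_le fun i => by
    have hP := hM t
    have hpos : 0 < M t i i := hβ.trans_le (hdiag t i)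
    have hrow : ∑ a, M t i a = 1 := Matrix.sum_row_of_mem_rowStochastic hP i
    -- The whole drift is charged to the agent's own value, divided by its weight `M t i i`. The new
    -- state is then an average of the `v a`, and Jensen applies to the square. The cross term has
    -- the favourable sign, and the quadratic term costs at most `C² α² / β`.
    set v : V → ℝ := fun a => x t a - z - (if a = i then α t * d t i / M t i i else 0) with hv
    have h1 : x (t + 1) i - z = ∑ a, M t i a * v a := by
      have : ∑ a, M t i a * v a = (M t).mulVec (x t) i - z - α t * d t i := by
        simp only [hv, mul_sub, Finset.sum_sub_distrib, ← Finset.sum_mul, hrow, mul_ite, mul_zero,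
          Finset.sum_ite_eq', Finset.mem_univ, if_true, one_mul, Matrix.mulVec, dotProduct]
        rw [mul_div_cancel₀ _ hpos.ne']
      rw [this, hx]
      simp only [Pi.sub_apply, Pi.smul_apply, smul_eq_mul]
      ring
    have h2 : (∑ a, M t i a * v a) ^ 2 ≤ ∑ a, M t i a * v a ^ 2 := by
      simpa using (even_two.convexOn_pow (𝕜 := ℝ)).map_sum_le (t := Finset.univ)
        (fun a _ => hP.1 i a) hrow (p := v) (fun a _ => Set.mem_univ _)
    have h3 : ∀ a, M t i a * v a ^ 2 ≤ M t i a * E t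
        + if a = i then α t ^ 2 * C ^ 2 / β else 0 := fun a => by
      have hEa : (x t a - z) ^ 2 ≤ E t := le_iSup_of_finite (fun a => (x t a - z) ^ 2) a
      by_cases ha : a = i
      · subst ha
        have e1 : M t a a * v a ^ 2 = M t a a * (x t a - z) ^ 2
            - 2 * (α t * (d t a * (x t a - z))) + (α t ^ 2 * d t a ^ 2) / M t a a := by
          simp only [hv, if_true]
          field_simp
          ring
        have e2 : (α t ^ 2 * d t a ^ 2) / M t a a ≤ α t ^ 2 * C ^ 2 / β := by
          have : d t a ^ 2 ≤ C ^ 2 := sq_le_sq' (abs_le.1 (hd t a)).1 (abs_le.1 (hd t a)).2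
          have := hdiag t a
          gcongr
        have e3 := mul_nonneg (hα t) (hz t a)
        have e4 := mul_le_mul_of_nonneg_left hEa hpos.le
        rw [e1, if_pos rfl]
        linarith
      · simp only [hv, if_neg ha, sub_zero, add_zero]
        exact mul_le_mul_of_nonneg_left hEa (hP.1 i a)
    rw [h1]
    refine h2.trans ((Finset.sum_le_sum fun a _ => h3 a).trans (le_of_eq ?_))
    rw [Finset.sum_add_distrib, ← Finset.sum_mul, hrow, Finset.sum_ite_eq']
    simp only [Finset.mem_univ, if_true]
    ring
  have hs := hα_sq.mul_left (C ^ 2 / β)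
  set S : ℕ → ℝ := fun t => ∑ r ∈ Finset.range t, C ^ 2 / β * α r ^ 2 with hS
  have hSt : Tendsto S atTop (𝓝 (∑' r, C ^ 2 / β * α r ^ 2)) := hs.hasSum.tendsto_sum_nat
  have hanti : Antitone fun t => E t - S t := antitone_nat_of_succ_le fun t => by
    have := hstep t
    simp only [hS, Finset.sum_range_succ]
    linarith
  have hterm : ∀ r, 0 ≤ C ^ 2 / β * α r ^ 2 := fun r => by positivity
  have hbdd : BddBelow (Set.range fun t => E t - S t) :=
    ⟨-∑' r, C ^ 2 / β * α r ^ 2, by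
      rintro _ ⟨t, rfl⟩
      have := hs.sum_le_tsum (Finset.range t) fun r _ => hterm r
      have := hE0 t
      simp only [hS]
      linarith⟩
  exact ⟨_, by simpa using (tendsto_atTop_ciInf hanti hbdd).add hSt⟩

/-- If the limit of `|y t|` is positive, a change of sign would need a jump larger than `r`, so the
sign is eventually constant. -/
theorem exists_tendsto_of_tendsto_abs {y : ℕ → ℝ} {r : ℝ}
    (hy : Tendsto (fun t => |y t|) atTop (𝓝 r))
    (hstep : Tendsto (fun t => y (t + 1) - y t) atTop (𝓝 0)) :
    ∃ p, Tendsto y atTop (𝓝 p) := by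
  have hr : 0 ≤ r := ge_of_tendsto' hy fun t => abs_nonneg _
  rcases hr.eq_or_lt with h0 | hpos
  · subst h0
    exact ⟨0, (tendsto_zero_iff_abs_tendsto_zero y).2 hy⟩
  have h1 : ∀ᶠ t in atTop, r / 2 < |y t| := hy.eventually (lt_mem_nhds (half_lt_self hpos))
  have h2 : ∀ᶠ t in atTop, |y (t + 1) - y t| < r := by
    have := hstep.abs
    rw [abs_zero] at this
    exact this.eventually (gt_mem_nhds hpos)
  obtain ⟨T, hT⟩ := eventually_atTop.1 (h1.and h2)
  by_cases hsign : 0 < y T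
  · have hall : ∀ t ≥ T, 0 < y t := fun t ht => by
      induction t, ht using Nat.le_induction with
      | base => exact hsign
      | succ t ht ih =>
        by_contra! hneg
        have a1 := (hT t ht).1
        have a2 := (hT (t + 1) (by omega)).1
        have a3 := (abs_lt.1 (hT t ht).2).1
        rw [abs_of_pos ih] at a1
        rw [abs_of_nonpos hneg] at a2
        linarith
    refine ⟨r, hy.congr' ?_⟩
    filter_upwards [eventually_ge_atTop T] with t ht using abs_of_pos (hall t ht)
  · have hall : ∀ t ≥ T, y t ≤ 0 := fun t ht => by
      induction t, ht using Nat.le_induction with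
      | base => exact not_lt.1 hsign
      | succ t ht ih =>
        by_contra! hp
        have a1 := (hT t ht).1
        have a2 := (hT (t + 1) (by omega)).1
        have a3 := (abs_lt.1 (hT t ht).2).2
        rw [abs_of_nonpos ih] at a1
        rw [abs_of_pos hp] at a2
        linarith
    refine ⟨-r, hy.neg.congr' ?_⟩
    filter_upwards [eventually_ge_atTop T] with t ht
    rw [abs_of_nonpos (hall t ht), neg_neg]

end Transition

/-! ### Trimmed means as averages of non-faulty states -/

section Trimming

variable {n : ℕ}

/-- A value between those of two families is a convex combination of both that puts substantial
weight on every member of one of them. -/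
theorem exists_weights_of_between {P Q : Finset (Fin n)} (hP : P.Nonempty) (hQ : Q.Nonempty)
    {x : Fin n → ℝ} {u : ℝ} (hPu : ∀ p ∈ P, x p ≤ u) (hQu : ∀ q ∈ Q, u ≤ x q) :
    ∃ c : Fin n → ℝ, (∀ j, 0 ≤ c j) ∧ ∑ j, c j = 1 ∧ ∑ j, c j * x j = u ∧
      (∀ j, j ∉ P → j ∉ Q → c j = 0) ∧
      ((∀ p ∈ P, 1 / (2 * (n : ℝ)) ≤ c p) ∨ ∀ q ∈ Q, 1 / (2 * (n : ℝ)) ≤ c q) := by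
  have hPc : (0 : ℝ) < P.card := by exact_mod_cast hP.card_pos
  have hQc : (0 : ℝ) < Q.card := by exact_mod_cast hQ.card_pos
  have hlow : (∑ p ∈ P, x p) / P.card ≤ u := by
    rw [div_le_iff₀ hPc]
    simpa [mul_comm] using Finset.sum_le_card_nsmul P x u hPu
  have hhigh : u ≤ (∑ q ∈ Q, x q) / Q.card := by
    rw [le_div_iff₀ hQc]
    simpa [mul_comm] using Finset.card_nsmul_le_sum Q x u hQu
  -- `u` lies between the means of `x` over `P` and over `Q`. One of the two coefficients is at
  -- least `1/2`, and each mean spreads its coefficient evenly over at most `n` members.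
  have hmem : u ∈ segment ℝ ((∑ p ∈ P, x p) / P.card) ((∑ q ∈ Q, x q) / Q.card) := by
    rw [segment_eq_Icc (hlow.trans hhigh)]
    exact ⟨hlow, hhigh⟩
  obtain ⟨a, b, ha, hb, hab, hu⟩ := hmem
  simp only [smul_eq_mul] at hu
  have hbound : ∀ R : Finset (Fin n), R.Nonempty → ∀ θ : ℝ, 1 / 2 ≤ θ →
      1 / (2 * (n : ℝ)) ≤ θ * (1 / R.card) := by
    intro R hR θ hθ
    have h1 : (0 : ℝ) < R.card := by exact_mod_cast hR.card_pos
    have h2 : (R.card : ℝ) ≤ n := by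
      exact_mod_cast (Finset.card_le_univ R).trans_eq (Fintype.card_fin n)
    rw [show 1 / (2 * (n : ℝ)) = 1 / 2 * (1 / n) by ring]
    gcongr
  have hnn : ∀ R : Finset (Fin n), ∀ j, (0 : ℝ) ≤ if j ∈ R then 1 / (R.card : ℝ) else 0 := by
    intro R j
    split_ifs <;> positivity
  refine ⟨fun j => a * (if j ∈ P then 1 / (P.card : ℝ) else 0)
    + b * (if j ∈ Q then 1 / (Q.card : ℝ) else 0), fun j => ?_, ?_, ?_, ?_, ?_⟩
  · exact add_nonneg (mul_nonneg ha (hnn P j)) (mul_nonneg hb (hnn Q j))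
  · rw [Finset.sum_add_distrib, ← Finset.mul_sum, ← Finset.mul_sum, Finset.sum_ite_mem,
      Finset.sum_ite_mem]
    simp only [Finset.univ_inter, Finset.sum_const, nsmul_eq_mul]
    rw [mul_one_div_cancel hPc.ne', mul_one_div_cancel hQc.ne']
    linarith
  · simp only [add_mul, mul_assoc, ite_mul, zero_mul]
    rw [Finset.sum_add_distrib, ← Finset.mul_sum, ← Finset.mul_sum, Finset.sum_ite_mem,
      Finset.sum_ite_mem]
    simp only [Finset.univ_inter, one_div_mul_eq_div, ← Finset.sum_div]
    exact hu
  · intro j hjP hjQ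
    simp [hjP, hjQ]
  · rcases le_total (1 / 2) a with h | h
    · left
      intro p hp
      simp only [hp, if_true]
      have := hbound P hP a h
      have := mul_nonneg hb (hnn Q p)
      linarith
    · right
      intro q hq
      simp only [hq, if_true]
      have := hbound Q hQ b (by linarith)
      have := mul_nonneg ha (hnn P q)
      linarith

/-- The value of a surviving sender `k`, as a convex combination of non-faulty states. -/
theorem exists_sender_weights {F P Q : Finset (Fin n)} (hPF : ∀ p ∈ P, p ∉ F)
    (hQF : ∀ q ∈ Q, q ∉ F) {x : Fin n → ℝ} {u : ℝ} {k : Fin n} (hk : k ∉ F → x k = u)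
    (hPu : ∀ p ∈ P, x p ≤ u) (hQu : ∀ q ∈ Q, u ≤ x q)
    (hne : k ∈ F → P.Nonempty ∧ Q.Nonempty) :
    ∃ c : Fin n → ℝ, (∀ j, 0 ≤ c j) ∧ ∑ j, c j = 1 ∧ ∑ j, c j * x j = u ∧
      (∀ j ∈ F, c j = 0) ∧ (k ∉ F → 1 / 2 ≤ c k) ∧
      ((∀ p ∈ P, 1 / (4 * (n : ℝ)) ≤ c p) ∨ ∀ q ∈ Q, 1 / (4 * (n : ℝ)) ≤ c q) := by
  have hhalf : 1 / (4 * (n : ℝ)) = 1 / 2 * (1 / (2 * (n : ℝ))) := by ring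
  by_cases hPQ : P.Nonempty ∧ Q.Nonempty
  · obtain ⟨c, h0, h1, hu, hz, hc⟩ := exists_weights_of_between hPQ.1 hPQ.2 hPu hQu
    have hcF : ∀ j ∈ F, c j = 0 := fun j hj =>
      hz j (fun h => hPF j h hj) fun h => hQF j h hj
    have hle : 1 / (4 * (n : ℝ)) ≤ 1 / (2 * (n : ℝ)) := by
      rw [hhalf]
      have : 0 ≤ 1 / (2 * (n : ℝ)) := by positivity
      linarith
    by_cases hkF : k ∈ F
    · exact ⟨c, h0, h1, hu, hcF, fun h => absurd hkF h,
        hc.imp (fun h p hp => hle.trans (h p hp)) fun h q hq => hle.trans (h q hq)⟩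
    -- A non-faulty `k` gives half of the weight to its own state and half to the combination from
    -- `P` and `Q`; this halves `1/(2n)` to `1/(4n)`.
    · have hδ : ∀ j, (0 : ℝ) ≤ if j = k then 1 / 2 else 0 := fun j => by
        split_ifs <;> norm_num
      have hbig : ∀ j, 1 / (2 * (n : ℝ)) ≤ c j →
          1 / (4 * (n : ℝ)) ≤ (if j = k then 1 / 2 else 0) + 1 / 2 * c j := fun j hj => by
        rw [hhalf]
        linarith [hδ j]
      refine ⟨fun j => (if j = k then 1 / 2 else 0) + 1 / 2 * c j, fun j => ?_, ?_, ?_,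
        fun j hj => ?_, fun _ => ?_,
        hc.imp (fun h p hp => hbig p (h p hp)) fun h q hq => hbig q (h q hq)⟩
      · linarith [hδ j, h0 j]
      · rw [Finset.sum_add_distrib, ← Finset.mul_sum, h1, Finset.sum_ite_eq']
        norm_num
      · simp only [add_mul, mul_assoc, ite_mul, zero_mul]
        rw [Finset.sum_add_distrib, ← Finset.mul_sum, hu, Finset.sum_ite_eq',
          if_pos (Finset.mem_univ k), hk hkF]
        ring
      · simp [hcF j hj, show j ≠ k from fun h => hkF (h ▸ hj)]
      · simpa using h0 k
  -- All weight goes to `k` itself; the last alternative holds vacuously for the empty one of `P`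
  -- and `Q`.
  · have hkF : k ∉ F := fun h => hPQ (hne h)
    refine ⟨Pi.single k 1, fun j => ?_, ?_, ?_, fun j hj => ?_, fun _ => ?_, ?_⟩
    · exact (Pi.single_nonneg.2 zero_le_one : (0 : Fin n → ℝ) ≤ Pi.single k 1) j
    · simp
    · simp [Pi.single_apply, hk hkF]
    · exact Pi.single_eq_of_ne (show j ≠ k from fun h => hkF (h ▸ hj)) _
    · rw [Pi.single_eq_same]
      norm_num
    · rcases not_and_or.1 hPQ with h | h
      · left
        simp [Finset.not_nonempty_iff_eq_empty.1 h]
      · right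
        simp [Finset.not_nonempty_iff_eq_empty.1 h]

/-- The value of a sender that survives the trimming, as a convex combination of non-faulty
states with substantial weight on all non-faulty members of one of the trimmed sets. -/
theorem exists_surviving_sender_weights {f : ℕ} {F N Lo Hi : Finset (Fin n)} {w x : Fin n → ℝ}
    {k : Fin n} (hF : F.card ≤ f) (hLoN : Lo ⊆ N) (hHiN : Hi ⊆ N) (hLoc : Lo.card = f)
    (hHic : Hi.card = f) (hLo : ∀ a ∈ Lo, ∀ b ∈ N \ Lo, w a ≤ w b)
    (hHi : ∀ a ∈ Hi, ∀ b ∈ N \ Hi, w b ≤ w a) (hw : ∀ j ∈ N, j ∉ F → w j = x j)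
    (hk : k ∈ N \ (Lo ∪ Hi)) :
    ∃ c : Fin n → ℝ, (∀ j, 0 ≤ c j) ∧ ∑ j, c j = 1 ∧ ∑ j, c j * x j = w k ∧
      (∀ j ∈ F, c j = 0) ∧ (k ∉ F → 1 / 2 ≤ c k) ∧
      ((∀ p ∈ Lo \ F, 1 / (4 * (n : ℝ)) ≤ c p) ∨ ∀ q ∈ Hi \ F, 1 / (4 * (n : ℝ)) ≤ c q) := by
  -- If all `f` members of `R` were faulty, a faulty `k` outside `R` would be fault number `f + 1`.
  have hout : ∀ R : Finset (Fin n), R.card = f → ∀ k ∈ F, k ∉ R → (R \ F).Nonempty := by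
    intro R hR k hk hkR
    by_contra hemp
    have hsub : R ⊆ F := Finset.sdiff_eq_empty_iff_subset.1
      (Finset.not_nonempty_iff_eq_empty.1 hemp)
    have := Finset.card_le_card (Finset.insert_subset hk hsub)
    rw [Finset.card_insert_of_notMem hkR] at this
    omega
  obtain ⟨hkN, hkLH⟩ := Finset.mem_sdiff.1 hk
  have hkLo : k ∉ Lo := fun h => hkLH (Finset.mem_union_left _ h)
  have hkHi : k ∉ Hi := fun h => hkLH (Finset.mem_union_right _ h)
  refine exists_sender_weights (fun p hp => (Finset.mem_sdiff.1 hp).2)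
    (fun q hq => (Finset.mem_sdiff.1 hq).2) (fun h => (hw k hkN h).symm) (fun p hp => ?_)
    (fun q hq => ?_) fun h => ⟨hout Lo hLoc k h hkLo, hout Hi hHic k h hkHi⟩
  · obtain ⟨hp, hpF⟩ := Finset.mem_sdiff.1 hp
    rw [← hw p (hLoN hp) hpF]
    exact hLo p hp k (Finset.mem_sdiff.2 ⟨hkN, hkLo⟩)
  · obtain ⟨hq, hqF⟩ := Finset.mem_sdiff.1 hq
    rw [← hw q (hHiN hq) hqF]
    exact hHi q hq k (Finset.mem_sdiff.2 ⟨hkN, hkHi⟩)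

open Classical in
/-- The trimmed mean of a non-faulty agent is a convex combination of non-faulty states which
neglects at most `f` of the non-faulty senders. -/
theorem exists_trimmedMean_weights {f : ℕ} {F N K : Finset (Fin n)} {w x : Fin n → ℝ} {i : Fin n}
    (hF : F.card ≤ f) (hiF : i ∉ F) (hiN : i ∉ N) (hK : IsTrimming f N w K)
    (hKne : f ≠ 0 → K.Nonempty) (hwi : w i = x i) (hw : ∀ j ∈ N, j ∉ F → w j = x j) :
    ∃ c : Fin n → ℝ, (∀ j, 0 ≤ c j) ∧ ∑ j, c j = 1 ∧
      ∑ j ∈ insert i K, (1 / ((K.card : ℝ) + 1)) * w j = ∑ j, c j * x j ∧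
      (∀ j ∈ F, c j = 0) ∧ 1 / (4 * (n : ℝ) ^ 2) ≤ c i ∧
      (N.filter fun j => j ∉ F ∧ ¬ 1 / (4 * (n : ℝ) ^ 2) ≤ c j).card ≤ f := by
  obtain ⟨Lo, Hi, hLoN, hHiN, hdisj, hLoc, hHic, rfl, hLo, hHi⟩ := hK
  obtain ⟨K, hKdef⟩ : ∃ K, K = N \ (Lo ∪ Hi) := ⟨_, rfl⟩
  rw [← hKdef] at hKne ⊢
  have hKmem : ∀ k, k ∈ K ↔ k ∈ N ∧ k ∉ Lo ∧ k ∉ Hi := by simp [hKdef]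
  have hex := fun k hk => exists_surviving_sender_weights hF hLoN hHiN hLoc hHic hLo hHi hw
    (k := k) (hKdef ▸ hk)
  choose! C hC0 hC1 hCw hCF hCk hCd using hex
  have hiK : i ∉ K := fun h => hiN ((hKmem i).1 h).1
  obtain ⟨a, ha⟩ : ∃ a : ℝ, a = 1 / ((K.card : ℝ) + 1) := ⟨_, rfl⟩
  rw [← ha]
  have hnpos : (0 : ℝ) < n := by exact_mod_cast i.pos
  have hK1 : (0 : ℝ) < K.card + 1 := Nat.cast_add_one_pos _
  have ha0 : 0 < a := ha ▸ one_div_pos.2 hK1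
  have haK : a * (1 + K.card) = 1 := by
    rw [ha, add_comm (1 : ℝ)]
    exact one_div_mul_cancel hK1.ne'
  have han : 1 / (n : ℝ) ≤ a := by
    have h1 : (insert i K).card ≤ n :=
      (Finset.card_le_univ _).trans_eq (Fintype.card_fin n)
    rw [Finset.card_insert_of_notMem hiK] at h1
    have h2 : (K.card : ℝ) + 1 ≤ n := by exact_mod_cast h1
    exact ha ▸ one_div_le_one_div_of_le hK1 h2
  set c : Fin n → ℝ := fun j => a * ((if j = i then 1 else 0) + ∑ k ∈ K, C k j) with hc
  have hCsum : ∀ j, 0 ≤ ∑ k ∈ K, C k j := fun j => Finset.sum_nonneg fun k hk => hC0 k hk j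
  have hδ : ∀ j, (0 : ℝ) ≤ if j = i then 1 else 0 := fun j => by split_ifs <;> norm_num
  have hn1 : (1 : ℝ) ≤ n := by exact_mod_cast i.pos
  -- The factor `1/n` bounds the averaging weight `a` from below; `1/(4n)` is the weight inside one
  -- survivor's combination.
  have hβ : 1 / (4 * (n : ℝ) ^ 2) = 1 / (n : ℝ) * (1 / (4 * n)) := by
    rw [one_div_mul_one_div]
    congr 1
    ring
  have hβ' : 1 / (4 * (n : ℝ)) ≤ 1 / 2 := one_div_le_one_div_of_le (by norm_num) (by linarith)
  have hge : ∀ k ∈ K, ∀ j, 1 / (4 * (n : ℝ)) ≤ C k j → 1 / (4 * (n : ℝ) ^ 2) ≤ c j := by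
    intro k hk j hj
    have h1 : C k j ≤ ∑ k ∈ K, C k j :=
      Finset.single_le_sum (f := fun k => C k j) (fun k hk => hC0 k hk j) hk
    rw [hβ]
    exact mul_le_mul han (by linarith [hδ j]) (by positivity) ha0.le
  refine ⟨c, fun j => mul_nonneg ha0.le (add_nonneg (hδ j) (hCsum j)), ?_, ?_, fun j hj => ?_,
    ?_, ?_⟩
  · rw [hc, ← Finset.mul_sum, Finset.sum_add_distrib, Finset.sum_ite_eq', Finset.sum_comm,
      Finset.sum_congr rfl hC1, if_pos (Finset.mem_univ i), Finset.sum_const, nsmul_one, haK]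
  · rw [← Finset.mul_sum, Finset.sum_insert hiK, hwi]
    simp only [hc, mul_assoc, add_mul, ite_mul, zero_mul, one_mul, Finset.sum_mul]
    rw [← Finset.mul_sum, Finset.sum_add_distrib, Finset.sum_ite_eq', Finset.sum_comm,
      Finset.sum_congr rfl hCw, if_pos (Finset.mem_univ i)]
  · simp only [hc]
    rw [if_neg (show j ≠ i from fun h => hiF (h ▸ hj)), Finset.sum_eq_zero fun k hk => hCF k hk j hj, add_zero,
      mul_zero]
  · rw [hβ]
    refine mul_le_mul han ?_ (by positivity) ha0.le
    rw [if_pos rfl]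
    linarith [hCsum i]
  · rcases K.eq_empty_or_nonempty with hKe | ⟨k, hk⟩
    · have hf : f = 0 := by
        by_contra h
        exact (hKne h).ne_empty hKe
      have hLo0 : Lo = ∅ := Finset.card_eq_zero.1 (hLoc.trans hf)
      have hHi0 : Hi = ∅ := Finset.card_eq_zero.1 (hHic.trans hf)
      have hN : N = ∅ := by simpa [hKdef, hLo0, hHi0] using hKe
      simp [hN]
    · have hmiss : ∀ j ∈ N, j ∉ F → ¬ 1 / (4 * (n : ℝ) ^ 2) ≤ c j → j ∈ Lo ∨ j ∈ Hi := by
        intro j hj hjF hlt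
        by_contra! hcon
        have hjK : j ∈ K := (hKmem j).2 ⟨hj, hcon⟩
        exact hlt (hge j hjK j (hβ'.trans (hCk j hjK hjF)))
      -- A single survivor suffices: its combination covers the non-faulty part of `Lo` or of `Hi`,
      -- so the neglected senders all lie in the other set, which has `f` elements.
      rcases hCd k hk with hP | hQ
      · rw [← hHic]
        refine Finset.card_le_card fun j hj => ?_
        obtain ⟨hjN, hjF, hlt⟩ := Finset.mem_filter.1 hj
        refine (hmiss j hjN hjF hlt).resolve_left fun h => hlt ?_
        exact hge k hk j (hP j (Finset.mem_sdiff.2 ⟨h, hjF⟩))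
      · rw [← hLoc]
        refine Finset.card_le_card fun j hj => ?_
        obtain ⟨hjN, hjF, hlt⟩ := Finset.mem_filter.1 hj
        refine (hmiss j hjN hjF hlt).resolve_right fun h => hlt ?_
        exact hge k hk j (hQ j (Finset.mem_sdiff.2 ⟨h, hjF⟩))

/-- Under the source condition with `f ≠ 0`, every trimming leaves a sender. -/
theorem SourceCondition.trimming_nonempty {G : Digraph (Fin n)} {f s : ℕ}
    (hcond : SourceCondition G f s) (hG : ∀ i, ¬ G.Adj i i) (hf : f ≠ 0) {i : Fin n}
    {w : Fin n → ℝ} {K : Finset (Fin n)} (hK : IsTrimming f (inNbrs G i) w K) : K.Nonempty := by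
  obtain ⟨Lo, Hi, hLoN, hHiN, hdisj, hLoc, hHic, rfl, -, -⟩ := hK
  by_contra hemp
  have hsub : inNbrs G i ⊆ Lo ∪ Hi := Finset.sdiff_eq_empty_iff_subset.1
    (Finset.not_nonempty_iff_eq_empty.1 hemp)
  have hiLo : i ∉ Lo := fun h => hG i (by simpa [inNbrs] using hLoN h)
  -- With `Lo` as fault set, the remaining in-edges of `i` come from `Hi`, so there are at most `f`
  -- of them and all may be removed. Then no other node reaches `i`, and the source component has at
  -- most one node, fewer than `f + 1`.
  let H : Digraph {a : Fin n // a ∉ Lo} := ⟨fun a b => G.Adj a b ∧ (b : Fin n) ≠ i⟩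
  have hH : IsReduced G f Lo H := by
    refine ⟨fun a b h => h.1, fun b => ?_⟩
    by_cases hb : (b : Fin n) = i
    · rw [← hHic, ← Set.ncard_coe_finset Hi,
        ← Set.ncard_image_of_injective _ Subtype.val_injective]
      refine Set.ncard_le_ncard ?_ (Finset.finite_toSet Hi)
      rintro _ ⟨a, ⟨ha, -⟩, rfl⟩
      rw [hb] at ha
      exact (Finset.mem_union.1 (hsub (by simpa [inNbrs] using ha))).resolve_left a.2
    · have : {a : {a : Fin n // a ∉ Lo} | G.Adj a b ∧ ¬ H.Adj a b} = ∅ := by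
        ext a
        simp [H, hb]
      rw [this]
      simp
  have hsrc : sourceComponent H ⊆ {⟨i, hiLo⟩} := by
    intro v hv
    by_contra hne
    rcases Relation.ReflTransGen.cases_tail (hv ⟨i, hiLo⟩ fun h => hne h.symm) with h | ⟨b, -, hb⟩
    · exact hne h.symm
    · exact hb.2 rfl
  have h1 := hcond Lo hLoc.le H hH
  have h2 := Set.ncard_le_ncard hsrc (Set.finite_singleton _)
  rw [Set.ncard_singleton] at h2
  have := (le_max_left _ _).trans (h1.trans h2)
  omega

/-- A set with at least `sparsity A` elements, none of them faulty, contains an agent with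
positive weight on any given input function. -/
theorem exists_pos_of_sparsity_le {k : ℕ} {A : Matrix (Fin k) (Fin n) ℝ} {F : Finset (Fin n)}
    {T : Set {i : Fin n // i ∉ F}} (hT : sparsity A ≤ T.ncard) (j : Fin k) :
    ∃ i ∈ T, 0 < A j i := by
  classical
  have hle : (T.toFinset.map (Function.Embedding.subtype _)).card ≤ n :=
    (Finset.card_le_univ _).trans_eq (Fintype.card_fin n)
  have hcard : T.ncard = (T.toFinset.map (Function.Embedding.subtype _)).card := by
    rw [Finset.card_map, Set.ncard_eq_toFinset_card']
  rw [hcard] at hT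
  by_cases hpos : ∀ j, 0 < ∑ i, A j i
  · have hmem : sparsity A ∈ {s : ℕ | ∀ I : Finset (Fin n), I.card = s →
        ∀ j, 0 < ∑ i ∈ I, A j i} := by
      rw [sparsity, if_pos hpos]
      -- The set contains `n`, so its infimum is attained and is not the default value `0` of an
      -- empty infimum.
      refine Nat.sInf_mem ⟨n, fun I hI j => ?_⟩
      have : I = Finset.univ := (Finset.card_eq_iff_eq_univ I).1 (by simpa using hI)
      exact this ▸ hpos j
    obtain ⟨I, hIT, hI⟩ := Finset.exists_subset_card_eq hT
    obtain ⟨i, hi, hAi⟩ := Finset.exists_lt_of_sum_lt (f := fun _ => (0 : ℝ))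
      (by simpa using hmem I hI j)
    obtain ⟨v, hv, rfl⟩ := Finset.mem_map.1 (hIT hi)
    exact ⟨v, Set.mem_toFinset.1 hv, hAi⟩
  -- The conventional value `n + 1` exceeds the size of every set of agents.
  · rw [sparsity, if_neg hpos] at hT
    omega

end Trimming

/-! ### Convergence to a common limit -/

section Limit

variable {V : Type*} [Fintype V] [DecidableEq V] [Nonempty V]
variable {M : ℕ → Matrix V V ℝ} {x d : ℕ → V → ℝ} {α : ℕ → ℝ}

/-- Perturbed consensus with drifts directed towards a common point converges. -/
theorem exists_bound_and_common_limit (hM : ∀ t, M t ∈ Matrix.rowStochastic ℝ V)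
    (hx : ∀ t, x (t + 1) = (M t).mulVec (x t) - α t • d t) {β : ℝ} (hβ : 0 < β)
    (hdiag : ∀ t i, β ≤ M t i i) (hα : ∀ t, 0 ≤ α t) (hα_sq : Summable fun t => α t ^ 2) {C : ℝ}
    (hd : ∀ t i, |d t i| ≤ C) {z : ℝ} (hz : ∀ t i, 0 ≤ d t i * (x t i - z))
    {γ : ℝ} (hγ : 0 < γ) {N : ℕ} (hcol : ∀ s, ∃ j, ∀ i, γ ≤ transition M s N i j) :
    (∃ B, ∀ t i, |x t i| ≤ B) ∧ ∃ p, ∀ i, Tendsto (fun t => x t i) atTop (𝓝 p) := by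
  obtain ⟨e, he⟩ := exists_tendsto_iSup_sq_sub hM hx hβ hdiag hα_sq hd hz hα
  obtain ⟨b, hb⟩ := he.bddAbove_range
  have hdist : ∀ t i, |x t i - z| ≤ √b := fun t i => Real.abs_le_sqrt <|
    (le_iSup_of_finite (fun i => (x t i - z) ^ 2) i).trans (hb ⟨t, rfl⟩)
  have hB : ∀ t i, |x t i| ≤ √b + |z| := fun t i => by
    have := abs_add_le (x t i - z) z
    rw [sub_add_cancel] at this
    linarith [hdist t i]
  refine ⟨⟨_, hB⟩, ?_⟩
  have hα0 : Tendsto α atTop (𝓝 0) := by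
    have := hα_sq.tendsto_atTop_zero.sqrt
    simpa only [Real.sqrt_sq (hα _), Real.sqrt_zero] using this
  have hD := tendsto_spread_zero hM hx hα hα0 hd hB hγ hcol
  set D : ℕ → ℝ := fun t => (⨆ i, x t i) - ⨅ i, x t i with hDdef
  have hdiff : ∀ t i j, |x t i - x t j| ≤ D t := fun t i j => by
    have h1 := le_iSup_of_finite (x t) i
    have h2 := le_iSup_of_finite (x t) j
    have h3 := iInf_le_of_finite (x t) i
    have h4 := iInf_le_of_finite (x t) j
    exact abs_le.2 ⟨by simp only [hDdef]; linarith, by simp only [hDdef]; linarith⟩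
  obtain ⟨o⟩ := ‹Nonempty V›
  have hsq : Tendsto (fun t => (x t o - z) ^ 2) atTop (𝓝 e) := by
    -- Squared distances to `z` of two agents differ by at most the spread times `2 √b`, so one
    -- agent's squared distance has the same limit as the largest.
    have hlow : Tendsto (fun t => (⨆ i, (x t i - z) ^ 2) - D t * (2 * √b)) atTop (𝓝 e) := by
      simpa using he.sub (hD.mul_const (2 * √b))
    refine tendsto_of_tendsto_of_tendsto_of_le_of_le hlow he (fun t => ?_)
      fun t => le_iSup_of_finite (fun i => (x t i - z) ^ 2) o
    have : Nonempty V := ⟨o⟩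
    refine sub_le_iff_le_add.2 (ciSup_le fun i => ?_)
    have h1 : |(x t i - x t o) * ((x t i - z) + (x t o - z))| ≤ D t * (2 * √b) := by
      rw [abs_mul]
      refine mul_le_mul (hdiff t i o) ?_ (abs_nonneg _) ((abs_nonneg _).trans (hdiff t i o))
      linarith [abs_add_le (x t i - z) (x t o - z), hdist t i, hdist t o]
    linarith [(abs_le.1 h1).2]
  have habs : Tendsto (fun t => |x t o - z|) atTop (𝓝 √e) := by
    simpa only [Real.sqrt_sq_eq_abs] using hsq.sqrt
  have hstep : Tendsto (fun t => (x (t + 1) o - z) - (x t o - z)) atTop (𝓝 0) := by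
    have hup : Tendsto (fun t => D t + α t * C) atTop (𝓝 0) := by
      simpa using hD.add (hα0.mul_const C)
    refine squeeze_zero_norm (fun t => ?_) hup
    have h1 := mulVec_le_of_mem_rowStochastic (hM t) (u := x t) (b := x t o + D t)
      (fun a => by linarith [(abs_le.1 (hdiff t a o)).2]) o
    have h2 := add_le_mulVec_of_mem_rowStochastic (hM t) (u := x t) (b := x t o - D t) (γ := 0)
      (fun a => by linarith [(abs_le.1 (hdiff t a o)).1]) (i := o) (j := o) ((hM t).1 o o)
    have h3 : |α t * d t o| ≤ α t * C := by
      rw [abs_mul, abs_of_nonneg (hα t)]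
      exact mul_le_mul_of_nonneg_left (hd t o) (hα t)
    obtain ⟨h4, h5⟩ := abs_le.1 h3
    rw [Real.norm_eq_abs, hx]
    simp only [Pi.sub_apply, Pi.smul_apply, smul_eq_mul]
    exact abs_le.2 ⟨by linarith, by linarith⟩
  obtain ⟨p, hp⟩ := exists_tendsto_of_tendsto_abs habs hstep
  refine ⟨p + z, fun i => ?_⟩
  have h1 : Tendsto (fun t => x t i - x t o) atTop (𝓝 0) :=
    squeeze_zero_norm (fun t => hdiff t i o) hD
  simpa using h1.add (hp.add_const z)

end Limit

/-! ### Local costs and their subgradients -/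

section Costs

variable {n k : ℕ}

theorem IsSubgradientAt.abs_le {g : ℝ → ℝ} {L : ℝ≥0} (hg : LipschitzWith L g) {y d : ℝ}
    (hd : IsSubgradientAt g y d) : |d| ≤ L := by
  have h1 := hd (y + 1)
  have h2 := hd (y - 1)
  have h3 := hg.dist_le_mul (y + 1) y
  have h4 := hg.dist_le_mul (y - 1) y
  simp only [Real.dist_eq, add_sub_cancel_left, sub_sub_cancel_left, abs_neg, abs_one,
    mul_one] at h1 h2 h3 h4
  exact _root_.abs_le.2 ⟨by linarith [(_root_.abs_le.1 h4).2], by linarith [(_root_.abs_le.1 h3).2]⟩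

theorem lipschitzWith_localCost {A : Matrix (Fin k) (Fin n) ℝ} (hA : IsAssignment A) {L : ℝ≥0}
    {h : Fin k → ℝ → ℝ} (hh : ∀ j, LipschitzWith L (h j)) (i : Fin n) :
    LipschitzWith L (localCost A h i) := by
  refine LipschitzWith.of_dist_le_mul fun a b => ?_
  rw [Real.dist_eq, localCost, localCost, ← Finset.sum_sub_distrib]
  calc |∑ j, (A j i * h j a - A j i * h j b)|
      ≤ ∑ j, |A j i * h j a - A j i * h j b| := Finset.abs_sum_le_sum_abs _ _
    _ ≤ ∑ j, A j i * (L * dist a b) := Finset.sum_le_sum fun j _ => by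
        rw [← mul_sub, abs_mul, abs_of_nonneg (hA.nonneg j i), ← Real.dist_eq]
        exact mul_le_mul_of_nonneg_left ((hh j).dist_le_mul a b) (hA.nonneg j i)
    _ = L * dist a b := by rw [← Finset.sum_mul, hA.col_sum, one_mul]

/-- At a common minimizer, each weighted input function accounts for at most the excess of the
local cost. -/
theorem mul_sub_le_localCost_sub {A : Matrix (Fin k) (Fin n) ℝ} (hA : IsAssignment A)
    {h : Fin k → ℝ → ℝ} {z : ℝ} (hz : ∀ j, z ∈ argminSet (h j)) (i : Fin n) (j : Fin k) (y : ℝ) :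
    A j i * (h j y - h j z) ≤ localCost A h i y - localCost A h i z := by
  rw [localCost, localCost, ← Finset.sum_sub_distrib]
  simp only [← mul_sub]
  exact Finset.single_le_sum (f := fun l => A l i * (h l y - h l z))
    (fun l _ => mul_nonneg (hA.nonneg l i) (sub_nonneg.2 (hz l y))) (Finset.mem_univ j)

theorem mem_argminSet_localCost {A : Matrix (Fin k) (Fin n) ℝ} (hA : IsAssignment A)
    {h : Fin k → ℝ → ℝ} {z : ℝ} (hz : ∀ j, z ∈ argminSet (h j)) (i : Fin n) :
    z ∈ argminSet (localCost A h i) := fun y =>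
  Finset.sum_le_sum fun j _ => mul_le_mul_of_nonneg_left (hz j y) (hA.nonneg j i)

theorem IsSubgradientAt.sub_le_mul_sub {g : ℝ → ℝ} {y z d : ℝ} (hd : IsSubgradientAt g y d) :
    g y - g z ≤ d * (y - z) := by
  linarith [hd z]

theorem mem_argminSet_globalCost {h : Fin k → ℝ → ℝ} {z : ℝ} (hz : ∀ j, z ∈ argminSet (h j)) :
    z ∈ argminSet (globalCost h) := fun y =>
  mul_le_mul_of_nonneg_left (Finset.sum_le_sum fun j _ => hz j y) (by positivity)

end Costs

/-! ### Executions as averaging with drift -/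

section Execution

variable {n : ℕ}

/-- The non-faulty states of an execution evolve by row-stochastic matrices that dominate
reduced graphs. -/
theorem IsExecution.exists_rowStochastic {G : Digraph (Fin n)} (hG : ∀ i, ¬ G.Adj i i)
    {f s : ℕ} {F : Finset (Fin n)} (hF : F.card ≤ f) (hcond : SourceCondition G f s)
    {g : Fin n → ℝ → ℝ} {α : ℕ → ℝ} {x : ℕ → Fin n → ℝ} {w : ℕ → Fin n → Fin n → ℝ}
    {K : ℕ → Fin n → Finset (Fin n)} {d : ℕ → Fin n → ℝ}
    (hexec : IsExecution G f F g α x w K d) :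
    ∃ (M : ℕ → Matrix {i : Fin n // i ∉ F} {i : Fin n // i ∉ F} ℝ)
      (H : ℕ → Digraph {i : Fin n // i ∉ F}),
      (∀ t, M t ∈ Matrix.rowStochastic ℝ _) ∧ (∀ t, IsReduced G f F (H t)) ∧
      (∀ t i, 1 / (4 * (n : ℝ) ^ 2) ≤ M t i i) ∧
      (∀ t i j, (H t).Adj j i → 1 / (4 * (n : ℝ) ^ 2) ≤ M t i j) ∧
      ∀ t, (fun i : {i : Fin n // i ∉ F} => x (t + 1) i)
        = (M t).mulVec (fun i => x t i) - α t • fun i : {i : Fin n // i ∉ F} => d t i := by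
  classical
  have hrow := fun t i (hi : i ∉ F) => exists_trimmedMean_weights hF hi
    (by simpa [inNbrs] using hG i) (hexec.trim t i hi)
    (fun hf => hcond.trimming_nonempty hG hf (hexec.trim t i hi)) (hexec.own t i hi)
    (hexec.received t i hi)
  choose c h0 h1 hmean hcF hdiag hmiss using hrow
  have hsub : ∀ u : Fin n → ℝ, (∀ j ∈ F, u j = 0) →
      ∑ j : {j : Fin n // j ∉ F}, u j = ∑ j, u j := by
    intro u hu
    rw [← Finset.sum_subtype (Finset.univ.filter fun j => j ∉ F) (by simp) u]
    exact Finset.sum_filter_of_ne (p := fun j => j ∉ F) fun j _ hj hjF => hj (hu j hjF)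
  refine ⟨fun t i j => c t i i.2 j,
    -- Exactly the edges of `G` between non-faulty agents with weight at least `1/(4n²)` are kept;
    -- the count of neglected senders makes this a reduced graph.
    fun t => ⟨fun j i => G.Adj j i ∧ 1 / (4 * (n : ℝ) ^ 2) ≤ c t i i.2 j⟩,
    fun t => Matrix.mem_rowStochastic_iff_sum.2 ⟨fun i j => h0 _ _ _ _, fun i => ?_⟩,
    fun t => ⟨fun i j h => h.1, fun i => ?_⟩, fun t i => hdiag _ _ _, fun t i j h => h.2,
    fun t => funext fun i => ?_⟩
  · exact (hsub _ (hcF t i i.2)).trans (h1 t i i.2)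
  · refine le_trans ?_ (hmiss t i i.2)
    rw [← Set.ncard_coe_finset, ← Set.ncard_image_of_injective _ Subtype.val_injective]
    refine Set.ncard_le_ncard ?_ (Finset.finite_toSet _)
    rintro _ ⟨j, ⟨hj, hj'⟩, rfl⟩
    simp only [Finset.coe_filter, Set.mem_ofPred_eq]
    exact ⟨by simpa [inNbrs] using hj, j.2, fun h => hj' ⟨hj, h⟩⟩
  · have := hsub (fun j => c t i i.2 j * x t j) fun j hj => by simp [hcF t i i.2 j hj]
    simp only [Pi.sub_apply, Pi.smul_apply, smul_eq_mul, Matrix.mulVec, dotProduct]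
    rw [hexec.update t i i.2, hmean t i i.2, this]

end Execution

end ByzOpt

/-! ### Identification of the limit -/

theorem theorem4 {n k : ℕ} (G : Digraph (Fin n)) (hG : ∀ i, ¬ G.Adj i i)
    (f : ℕ) (F : Finset (Fin n)) (hF : F.card ≤ f)
    (A : Matrix (Fin k) (Fin n) ℝ) (hA : ByzOpt.IsAssignment A)
    (hcond : ByzOpt.SourceCondition G f (ByzOpt.sparsity A))
    (L : ℝ≥0) (h : Fin k → ℝ → ℝ) (hadm : ∀ j, ByzOpt.Admissible L (h j))
    (hred : (⋂ j, ByzOpt.argminSet (h j)).Nonempty)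
    (α : ℕ → ℝ) (hα : ∀ t, 0 ≤ α t) (hα_sum : ¬ Summable α)
    (hα_sq : Summable fun t => α t ^ 2)
    (x : ℕ → Fin n → ℝ) (w : ℕ → Fin n → Fin n → ℝ)
    (K : ℕ → Fin n → Finset (Fin n)) (d : ℕ → Fin n → ℝ)
    (hexec : ByzOpt.IsExecution G f F (ByzOpt.localCost A h) α x w K d) :
    ∃ xstar ∈ ByzOpt.argminSet (ByzOpt.globalCost h),
      ∀ i ∉ F, Tendsto (fun t => x t i) atTop (𝓝 xstar) := by
  open ByzOpt in
  obtain ⟨z, hz⟩ := hred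
  have hz : ∀ j, z ∈ argminSet (h j) := Set.mem_iInter.1 hz
  obtain ⟨M, H, hM, hH, hdiag, hedge, hx⟩ := hexec.exists_rowStochastic hG hF hcond
  have hsource : ∀ t, max (f + 1) (sparsity A) ≤ (sourceComponent (H t)).ncard :=
    fun t => hcond F hF (H t) (hH t)
  have hsrcne : ∀ t, (sourceComponent (H t)).Nonempty := fun t =>
    Set.nonempty_of_ncard_ne_zero (by have := (le_max_left _ _).trans (hsource t); omega)
  obtain ⟨o, -⟩ := hsrcne 0
  have : Nonempty {i : Fin n // i ∉ F} := ⟨o⟩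
  have hn : (0 : ℝ) < n := by exact_mod_cast (o : Fin n).pos
  have hβ : 0 < 1 / (4 * (n : ℝ) ^ 2) := by positivity
  have hγ := pow_pos hβ
    (Fintype.card ({i : Fin n // i ∉ F} × {i : Fin n // i ∉ F}) + 1)
  have hcols := exists_source_columns_le_transition hM hβ.le hdiag hedge
  have hlip := lipschitzWith_localCost hA fun j => (hadm j).lipschitz
  have hd : ∀ t (i : {i : Fin n // i ∉ F}), |d t i| ≤ L := fun t i =>
    (hexec.subgrad t i i.2).abs_le (hlip i)
  have hdz : ∀ t (i : {i : Fin n // i ∉ F}), 0 ≤ d t i * (x t i - z) := fun t i =>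
    (sub_nonneg.2 (mem_argminSet_localCost hA hz i (x t i))).trans
      (hexec.subgrad t i i.2).sub_le_mul_sub
  obtain ⟨⟨B, hB⟩, p, hp⟩ := exists_bound_and_common_limit
    (x := fun t (i : {i : Fin n // i ∉ F}) => x t i) hM hx hβ hdiag hα hα_sq hd hdz hγ
    (fun s => (hcols s).elim fun t ht => (hsrcne t).elim fun j hj => ⟨j, ht j hj⟩)
  refine ⟨p, mem_argminSet_globalCost fun j => ?_, fun i hi => hp ⟨i, hi⟩⟩
  by_contra hpj
  have hgap : h j z < h j p := by
    by_contra! hle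
    exact hpj fun y => hle.trans (hz j y)
  have hpz : p ≠ z := fun h => by simp [h] at hgap
  let S : Set {i : Fin n // i ∉ F} := {i | 0 < A j i}
  let δ : {i : Fin n // i ∉ F} → ℝ := fun i => localCost A h i p - localCost A h i z
  have hδ : ∀ i ∈ S, 0 < δ i := fun i hi =>
    (mul_pos hi (sub_pos.2 hgap)).trans_le (mul_sub_le_localCost_sub hA hz i j p)
  obtain ⟨c, hc, hc0⟩ : ∃ c : ℝ, (∀ i, i ∈ S → c < δ i) ∧ 0 < c := by
    have h1 : ∀ᶠ c in 𝓝[>] (0 : ℝ), ∀ i, i ∈ S → c < δ i := eventually_all.2 fun i => by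
      by_cases hi : i ∈ S
      · filter_upwards [nhdsWithin_le_nhds (gt_mem_nhds (hδ i hi))] with c hc _ using hc
      · exact Eventually.of_forall fun c h => absurd h hi
    exact (h1.and self_mem_nhdsWithin).exists
  -- Scaling states and drifts by `p - z` treats `p < z` and `z < p` at once: the scaled drift is
  -- nonnegative exactly when the step does not lead from `z` towards `p`.
  refine hα_sum (summable_of_eventually_drift
    (x := fun t (i : {i : Fin n // i ∉ F}) => (p - z) * x t i)
    (d := fun t (i : {i : Fin n // i ∉ F}) => (p - z) * d t i) (B := |p - z| * B) (S := S) (c := c)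
    (N := Fintype.card ({i : Fin n // i ∉ F} × {i : Fin n // i ∉ F}) + 1) hM (fun t => ?_) hα (fun t i => ?_) hγ hc0 (fun s => ?_) ?_)
  · have h1 := congrArg (fun u => (p - z) • u) (hx t)
    simp only [smul_sub, ← Matrix.mulVec_smul] at h1
    rw [smul_comm] at h1
    exact h1
  · rw [abs_mul]
    exact mul_le_mul_of_nonneg_left (hB t i) (abs_nonneg _)
  · obtain ⟨t, ht⟩ := hcols s
    obtain ⟨i, hi, hAi⟩ := exists_pos_of_sparsity_le ((le_max_right _ _).trans (hsource t)) j
    exact ⟨i, hAi, ht i hi⟩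
  · refine (eventually_all.2 fun i => ?_).and (eventually_all.2 fun i => ?_)
    · have hsq : Tendsto (fun t => (p - z) * (x t i - z)) atTop (𝓝 ((p - z) * (p - z))) :=
        ((hp i).sub_const z).const_mul _
      filter_upwards [hsq.eventually (lt_mem_nhds (mul_self_pos.2 (sub_ne_zero.2 hpz)))]
        with t ht
      by_contra! hneg
      have hprod : (d t i * (x t i - z)) * ((p - z) * (p - z)) < 0 := by
        have := mul_neg_of_neg_of_pos hneg ht
        linarith
      exact hprod.not_ge (mul_nonneg (hdz t i) (mul_self_nonneg _))
    · by_cases hi : i ∈ S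
      -- Splitting `d (p - z) = d (x - z) + d (p - x)` bounds the scaled drift below by the excess
      -- of the local cost at `x` over `z` minus `L |p - x|`, which tends to `δ i > c`.
      · have hlow : Tendsto (fun t => localCost A h i (x t i) - localCost A h i z
            - L * |p - x t i|) atTop (𝓝 (δ i)) := by
          have h1 := ((hlip i).continuous.tendsto p).comp (hp i)
          have h2 := (((hp i).const_sub p).abs).const_mul (L : ℝ)
          simpa [δ] using (h1.sub_const (localCost A h i z)).sub h2
        filter_upwards [hlow.eventually (lt_mem_nhds (hc i hi))] with t ht _
        have h1 := (hexec.subgrad t i i.2).sub_le_mul_sub (z := z)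
        have h2 : |d t i * (p - x t i)| ≤ L * |p - x t i| := by
          rw [abs_mul]
          exact mul_le_mul_of_nonneg_right (hd t i) (abs_nonneg _)
        linarith [(abs_le.1 h2).1]
      · exact Eventually.of_forall fun t h => absurd h hi
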